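/- Let $p\ge 3$ be a prime, let $\overline{\mathbb Q}_p$ be an algebraic closure of $\mathbb Q_p$ with the absolute value extending the $p$-adic one, and for every $m\ge 0$ let $\zeta_{p^m}\in\overline{\mathbb Q}_p$ be a primitive $p^m$-th root of unity. Let $n\ge 1$, let $p^{1/p^n}\in\overline{\mathbb Q}_p$ be a root of $X^{p^n}-p$, and put $K_p^{m,n}=\mathbb Q_p(\zeta_{p^m},p^{1/p^n})$. Then $K_p^{2,n}$ has a uniformizer, and for every uniformizer $\pi_p^{2,n}$ of $K_p^{2,n}$ there exist polynomials $R_p^{m,n}\in\mathbb Z_{(p)}[T]$ and integers $\alpha_p^{m,n},\beta_p^{m,n}$ ($m\ge 3$) such that the elements defined recursively for $m\ge 3$ by $$\pi_p^{m,n}=(\zeta_{p^m}-1)^{\alpha_p^{m,n}}\cdot\bigl(\zeta_{p^m}-R_p^{m,n}(\pi_p^{m-1,n})\bigr)^{\beta_p^{m,n}}$$ satisfy: $\pi_p^{m,n}$ is a uniformizer of $K_p^{m,n}$ for all $m\ge 3$. Here a uniformizer of $K_p^{m,n}$ is a generator of the maximal ideal of its valuation ring. -/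

import Mathlib

namespace FalseTate

/-- The subring `ℤ_(p)` of `ℚ`: rational numbers whose reduced denominator is prime to `p`. -/
def localizedInt (p : ℕ) [hp : Fact p.Prime] : Subring ℚ where
  carrier := {x | ¬ p ∣ x.den}
  mul_mem' := fun {a b} ha hb h =>
    (hp.out.dvd_mul.mp (h.trans (Rat.mul_den_dvd a b))).elim ha hb
  one_mem' := by simpa using hp.out.one_lt.ne'
  add_mem' := fun {a b} ha hb h =>
    (hp.out.dvd_mul.mp (h.trans (Rat.add_den_dvd a b))).elim ha hb
  zero_mem' := by simpa using hp.out.one_lt.ne'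
  neg_mem' := fun {a} ha => by simpa using ha

/-- The field `ℚ_p(z, r)` inside the fixed algebraic closure of `ℚ_p`. For `z` a primitive
`p ^ m`-th root of unity and `r` a `p ^ n`-th root of `p` this is the layer `K^{m,n}` of the false
Tate curve extension. -/
noncomputable def layer (p : ℕ) [Fact p.Prime] (z r : PadicAlgCl p) :
    IntermediateField ℚ_[p] (PadicAlgCl p) :=
  IntermediateField.adjoin ℚ_[p] {z, r}

/-- `x` is a uniformizer of `K` (for the unique extension of the `p`-adic absolute value):
it lies in the maximal ideal `{y ∈ K : ‖y‖ < 1}` of the valuation ring `{y ∈ K : ‖y‖ ≤ 1}`, and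
every element of that ideal is a multiple of `x` in the valuation ring. -/
def IsUniformizer {p : ℕ} [Fact p.Prime] (K : IntermediateField ℚ_[p] (PadicAlgCl p))
    (x : PadicAlgCl p) : Prop :=
  x ∈ K ∧ ‖x‖ < 1 ∧ ∀ y ∈ K, ‖y‖ < 1 → ∃ z ∈ K, ‖z‖ ≤ 1 ∧ y = x * z

/-- The recursion `π_2 = ϖ` and
`π_m = (ζ_m - 1) ^ α_m * (ζ_m - R_m (π_{m-1})) ^ β_m` for `m ≥ 3`.
The values at indices `0` and `1` are never used. -/
noncomputable def recursiveSeq {p : ℕ} [Fact p.Prime] (ζ : ℕ → PadicAlgCl p)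
    (R : ℕ → Polynomial (localizedInt p)) (α β : ℕ → ℤ) (ϖ : PadicAlgCl p) :
    ℕ → PadicAlgCl p
  | 0 => ϖ
  | 1 => ϖ
  | 2 => ϖ
  | m + 3 =>
      (ζ (m + 3) - 1) ^ α (m + 3) *
        (ζ (m + 3) - Polynomial.aeval (recursiveSeq ζ R α β ϖ (m + 2)) (R (m + 3))) ^ β (m + 3)

end FalseTate

namespace FalseTate

open Polynomial

variable {p : ℕ} [Fact p.Prime]

/-! Each layer `K^{m,n}` with `m ≥ 1` is totally ramified over `ℚ_p`, of degree `φ(p^m) p^n`. Hence,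
with `L = K^{m-1,n}`, `M = K^{m,n}` and `π` a uniformizer of `M`, uniformizers of `L` have norm `‖π‖
^ p`, while `‖ζ_m - 1‖ = ‖π‖ ^ p ^ n`. It therefore suffices to find `ζ_m - R(ϖ)` whose
`π`-valuation `c` is prime to `p`: a Bézout relation `α p^n + β c = 1` supplies the exponents. Such
an `R` comes from approximating `ζ_m` by elements `x` of `L`. While `‖ζ_m - x‖` is a norm from `L`,
triviality of the residue field allows `x` to be improved by a fixed factor. As `L` is closed and
`ζ_m ∉ L`, this must fail at some `x` (`exists_norm_sub_ne`), and there `p ∤ c`. Truncating the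
`ϖ`-adic expansion of `x` gives an integer polynomial (`exists_zpow_mul_zpow`). For the degree,
`X^{p^n} - p` stays irreducible over every cyclotomic extension of `ℚ_p` because these are abelian
(`finrank_layer`). Applying this also to `ζ_m ω`, with `ω` a Teichmüller representative in the
layer, gives the trivial residue field (`trivialResidue_layer`). -/

/-- Every integral element of `M` is congruent to a rational integer. -/
def TrivialResidue (M : IntermediateField ℚ_[p] (PadicAlgCl p)) : Prop :=
  ∀ y ∈ M, ‖y‖ ≤ 1 → ∃ k : ℤ, ‖y - k‖ < 1

/-! ### Norms and ultrametric sums -/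

theorem norm_prime : ‖(p : PadicAlgCl p)‖ = (p : ℝ)⁻¹ := by
  rw [← map_natCast (algebraMap ℚ_[p] (PadicAlgCl p)), norm_algebraMap', Padic.norm_p]

theorem inv_prime_pos : (0 : ℝ) < (p : ℝ)⁻¹ :=
  inv_pos.mpr (Nat.cast_pos.mpr (Fact.out : p.Prime).pos)

theorem inv_prime_lt_one : (p : ℝ)⁻¹ < 1 :=
  inv_lt_one_of_one_lt₀ (Nat.one_lt_cast.mpr (Fact.out : p.Prime).one_lt)

theorem exists_int_norm_sub_lt_one (a : ℚ_[p]) (ha : ‖a‖ ≤ 1) : ∃ k : ℤ, ‖a - k‖ < 1 := by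
  obtain ⟨a, rfl⟩ : ∃ b : ℤ_[p], (b : ℚ_[p]) = a := ⟨⟨a, ha⟩, rfl⟩
  obtain ⟨n, -, hn⟩ := PadicInt.exists_mem_range (p := p) a
  rw [IsLocalRing.mem_maximalIdeal, PadicInt.mem_nonunits] at hn
  exact ⟨n, by rw [PadicInt.norm_def] at hn; exact_mod_cast hn⟩

theorem norm_algEquiv (σ : Gal(PadicAlgCl p/ℚ_[p])) (x : PadicAlgCl p) : ‖σ x‖ = ‖x‖ :=
  (spectralNorm_eq_of_equiv σ x).symm

theorem norm_le_norm_sum_of_injOn {ι : Type*} (s : Finset ι) (f : ι → PadicAlgCl p)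
    (hf : ∀ i ∈ s, ∀ j ∈ s, f i ≠ 0 → ‖f i‖ = ‖f j‖ → i = j) {i : ι} (hi : i ∈ s) :
    ‖f i‖ ≤ ‖∑ j ∈ s, f j‖ := by
  classical
  obtain ⟨k, hk, hmax⟩ := s.exists_max_image (fun j => ‖f j‖) ⟨i, hi⟩
  refine (hmax i hi).trans ?_
  by_cases hk0 : f k = 0
  · simp [hk0]
  rw [← Finset.add_sum_erase s f hk]
  have hlt : ‖∑ j ∈ s.erase k, f j‖ < ‖f k‖ := by
    rcases (s.erase k).eq_empty_or_nonempty with h | h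
    · simp [h, hk0]
    · have : Nonempty ι := ⟨i⟩
      obtain ⟨j, hj, hle⟩ := IsUltrametricDist.exists_norm_finsetSum_le (s.erase k) f
      have hj := hj h
      have hjs := Finset.mem_of_mem_erase hj
      refine hle.trans_lt (lt_of_le_of_ne (hmax j hjs) fun h => ?_)
      exact Finset.ne_of_mem_erase hj (hf k hk j hjs hk0 h.symm).symm
  rw [IsUltrametricDist.norm_add_eq_max_of_norm_ne_norm hlt.ne', max_eq_left hlt.le]

/-! ### Elements whose norm is a root of `‖p‖` -/

section RamifiedElement

variable {π : PadicAlgCl p} {e : ℕ} (hπ : ‖π‖ ^ e = (p : ℝ)⁻¹)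
include hπ

/-- Normalized so that `p` has valuation `e`, the nonzero terms have valuations in distinct classes
mod `e`, so no cancellation can occur. -/
theorem norm_le_norm_sum_smul_pow (a : Fin e → ℚ_[p]) (i : Fin e) :
    ‖a i • π ^ (i : ℕ)‖ ≤ ‖∑ j, a j • π ^ (j : ℕ)‖ := by
  have hp1 : 1 < (p : ℝ) := Nat.one_lt_cast.mpr (Fact.out : p.Prime).one_lt
  refine norm_le_norm_sum_of_injOn Finset.univ (fun j : Fin e => a j • π ^ (j : ℕ)) ?_
    (Finset.mem_univ i)
  intro i _ j _ hi hij
  have key : ∀ k : Fin e, a k • π ^ (k : ℕ) ≠ 0 →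
      ∃ v : ℤ, ‖a k • π ^ (k : ℕ)‖ ^ e = (p : ℝ) ^ (-(v * e + (k : ℕ)) : ℤ) := by
    intro k hk
    have hak : a k ≠ 0 := fun h => hk (by simp [h])
    refine ⟨(a k).valuation, ?_⟩
    rw [norm_smul, norm_pow, mul_pow, ← pow_mul, mul_comm (k : ℕ), pow_mul, hπ,
      Padic.norm_eq_zpow_neg_valuation hak, ← zpow_natCast, ← zpow_natCast, inv_zpow', ← zpow_mul,
      ← zpow_add₀ (by positivity)]
    congr 1
    ring
  have hj : a j • π ^ (j : ℕ) ≠ 0 := by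
    rw [← norm_ne_zero_iff] at hi ⊢
    rwa [← hij]
  obtain ⟨v, hv⟩ := key i hi
  obtain ⟨w, hw⟩ := key j hj
  have h := zpow_right_injective₀ (by positivity) hp1.ne' ((hv.symm.trans (by rw [hij])).trans hw)
  have hmod : ((i : ℕ) : ℤ) % e = ((j : ℕ) : ℤ) % e := by
    have : ((i : ℕ) : ℤ) = (j : ℕ) + e * (w - v) := by linarith
    rw [this, Int.add_mul_emod_self_left]
  rw [Int.emod_eq_of_lt (by positivity) (by exact_mod_cast i.2),
    Int.emod_eq_of_lt (by positivity) (by exact_mod_cast j.2)] at hmod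
  exact Fin.ext (by exact_mod_cast hmod)

theorem ramified_ne_zero (he : e ≠ 0) : π ≠ 0 := by
  rintro rfl
  rw [norm_zero, zero_pow he] at hπ
  exact inv_prime_pos.ne hπ

theorem linearIndependent_pow_of_norm_pow :
    LinearIndependent ℚ_[p] fun i : Fin e => π ^ (i : ℕ) := by
  rw [Fintype.linearIndependent_iff]
  intro a ha i
  have h := norm_le_norm_sum_smul_pow hπ a i
  rw [ha, norm_zero, norm_le_zero_iff, smul_eq_zero] at h
  exact h.resolve_right (pow_ne_zero _ (ramified_ne_zero hπ (i.pos.ne')))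

variable {M : IntermediateField ℚ_[p] (PadicAlgCl p)}

theorem linearIndependent_pow_of_norm_pow' (hM : π ∈ M) :
    LinearIndependent ℚ_[p] fun i : Fin e => (⟨π, hM⟩ : M) ^ (i : ℕ) := by
  refine LinearIndependent.of_comp M.val.toLinearMap ?_
  exact linearIndependent_pow_of_norm_pow hπ

variable [FiniteDimensional ℚ_[p] M]

theorem ramification_le_finrank (hM : π ∈ M) : e ≤ Module.finrank ℚ_[p] M := by
  simpa using (linearIndependent_pow_of_norm_pow' hπ hM).fintype_card_le_finrank

theorem trivialResidue_of_ramification_eq_finrank (hM : π ∈ M)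
    (he : e = Module.finrank ℚ_[p] M) : TrivialResidue M := by
  intro y hy hy1
  have he0 : 0 < e := he ▸ Module.finrank_pos
  have hlt : ‖π‖ < 1 := by
    by_contra! h
    exact (one_le_pow₀ h).not_gt (hπ.trans_lt inv_prime_lt_one)
  have : Nonempty (Fin e) := ⟨⟨0, he0⟩⟩
  let b := basisOfLinearIndependentOfCardEqFinrank (linearIndependent_pow_of_norm_pow' hπ hM)
    (by simpa using he)
  let a : Fin e → ℚ_[p] := fun i => b.repr ⟨y, hy⟩ i
  have hsum : y = ∑ j, a j • π ^ (j : ℕ) := by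
    have h := congrArg (fun z : M => (z : PadicAlgCl p)) (b.sum_repr ⟨y, hy⟩)
    simpa [b, a] using h.symm
  have hle : ∀ i, ‖a i‖ * ‖π‖ ^ (i : ℕ) ≤ 1 := fun i => by
    have h := norm_le_norm_sum_smul_pow hπ a i
    rw [← hsum, norm_smul, norm_pow] at h
    exact h.trans hy1
  have hp1 : 1 < (p : ℝ) := Nat.one_lt_cast.mpr (Fact.out : p.Prime).one_lt
  have hπ0 : 0 < ‖π‖ := norm_pos_iff.mpr (ramified_ne_zero hπ he0.ne')
  -- A nonintegral coefficient has norm at least `p`, which outweighs `‖π‖ ^ i > p⁻¹` for `i < e`.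
  have ha : ∀ i, ‖a i‖ ≤ 1 := by
    intro i
    by_contra! h
    have h0 : a i ≠ 0 := fun h' => by simp [h'] at h; linarith
    rw [Padic.norm_eq_zpow_neg_valuation h0] at h
    have hv := (one_lt_zpow_iff_right₀ hp1).mp h
    have hpa : (p : ℝ) ≤ ‖a i‖ := by
      rw [Padic.norm_eq_zpow_neg_valuation h0]
      simpa using zpow_le_zpow_right₀ hp1.le (show (1 : ℤ) ≤ -(a i).valuation by omega)
    have h2 : (p : ℝ)⁻¹ < ‖π‖ ^ (i : ℕ) := by
      rw [← hπ]
      exact pow_lt_pow_right_of_lt_one₀ hπ0 hlt i.2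
    have h3 : 1 < ‖a i‖ * ‖π‖ ^ (i : ℕ) := by
      calc (1 : ℝ) = p * (p : ℝ)⁻¹ := (mul_inv_cancel₀ (by positivity)).symm
        _ < p * ‖π‖ ^ (i : ℕ) := by gcongr
        _ ≤ _ := by gcongr
    exact h3.not_ge (hle i)
  obtain ⟨k, hk⟩ := exists_int_norm_sub_lt_one (a ⟨0, he0⟩) (ha _)
  refine ⟨k, ?_⟩
  have hsub : y - k = ∑ j, (a j - if j = ⟨0, he0⟩ then (k : ℚ_[p]) else 0) • π ^ (j : ℕ) := by
    simp only [sub_smul, Finset.sum_sub_distrib, ← hsum, ite_smul, zero_smul,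
      Finset.sum_ite_eq', Finset.mem_univ, if_true, pow_zero]
    simp [Algebra.smul_def]
  obtain ⟨j, -, hj⟩ := IsUltrametricDist.exists_norm_finsetSum_le (Finset.univ : Finset (Fin e))
    fun j => (a j - if j = ⟨0, he0⟩ then (k : ℚ_[p]) else 0) • π ^ (j : ℕ)
  rw [hsub]
  refine hj.trans_lt ?_
  rw [norm_smul, norm_pow]
  by_cases h0 : j = ⟨0, he0⟩
  · subst h0
    simpa using hk
  · rw [if_neg h0, sub_zero]
    have hj0 : (j : ℕ) ≠ 0 := fun h => h0 (Fin.ext h)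
    calc ‖a j‖ * ‖π‖ ^ (j : ℕ) ≤ 1 * ‖π‖ ^ (j : ℕ) := by gcongr; exact ha j
      _ < 1 := by rw [one_mul]; exact pow_lt_one₀ hπ0.le hlt hj0

end RamifiedElement

/-! ### Uniformizers and successive approximation -/

theorem mem_of_forall_exists_closer (W : Submodule ℚ_[p] (PadicAlgCl p))
    [FiniteDimensional ℚ_[p] W] {c : ℝ} (hc0 : 0 ≤ c) (hc : c < 1) (z : PadicAlgCl p)
    (h : ∀ x ∈ W, ∃ x' ∈ W, ‖z - x'‖ ≤ c * ‖z - x‖) : z ∈ W := by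
  have happ : ∀ N : ℕ, ∃ x ∈ W, ‖z - x‖ ≤ c ^ N * ‖z‖ := by
    intro N
    induction N with
    | zero => exact ⟨0, W.zero_mem, by simp⟩
    | succ N ih =>
      obtain ⟨x, hx, hxN⟩ := ih
      obtain ⟨x', hx', hle⟩ := h x hx
      refine ⟨x', hx', hle.trans ?_⟩
      rw [pow_succ', mul_assoc]
      gcongr
  have hcl : IsClosed (W : Set (PadicAlgCl p)) := W.closed_of_finiteDimensional
  choose x hx hxN using happ
  refine hcl.mem_of_tendsto (b := Filter.atTop) (f := x) ?_ (Filter.Eventually.of_forall hx)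
  rw [tendsto_iff_norm_sub_tendsto_zero]
  refine squeeze_zero (fun _ => norm_nonneg _) (fun N => (norm_sub_rev _ _).trans_le (hxN N)) ?_
  simpa using (tendsto_pow_atTop_nhds_zero_of_lt_one hc0 hc).mul_const ‖z‖

theorem isCompact_integers (M : IntermediateField ℚ_[p] (PadicAlgCl p))
    [FiniteDimensional ℚ_[p] M] : IsCompact {x : PadicAlgCl p | x ∈ M ∧ ‖x‖ ≤ 1} := by
  have : FiniteDimensional ℚ_[p] (Subalgebra.toSubmodule M.toSubalgebra) :=
    inferInstanceAs (FiniteDimensional ℚ_[p] M)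
  have : ProperSpace (Subalgebra.toSubmodule M.toSubalgebra) :=
    FiniteDimensional.proper ℚ_[p] _
  have h := (isCompact_closedBall (0 : Subalgebra.toSubmodule M.toSubalgebra) 1).image
    continuous_subtype_val
  convert h using 1
  ext x
  simp [and_comm]

theorem exists_isUniformizer (M : IntermediateField ℚ_[p] (PadicAlgCl p))
    [FiniteDimensional ℚ_[p] M] : ∃ π, IsUniformizer M π := by
  -- Open balls are closed in an ultrametric space, so the maximal ideal is compact and contains an
  -- element of largest norm.
  have hcl : IsClosed {x : PadicAlgCl p | ‖x‖ < 1} := by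
    have := IsUltrametricDist.isClosed_ball (0 : PadicAlgCl p) 1
    simpa [Metric.ball] using this
  have hpM : (p : PadicAlgCl p) ∈ M := natCast_mem M p
  obtain ⟨π, ⟨⟨hπM, -⟩, hπ⟩, hmax⟩ := ((isCompact_integers M).inter_right hcl).exists_isMaxOn
    ⟨p, ⟨hpM, norm_prime.trans_le inv_prime_lt_one.le⟩, norm_prime.trans_lt inv_prime_lt_one⟩
    continuous_norm.continuousOn
  have hmax' : ∀ y ∈ M, ‖y‖ < 1 → ‖y‖ ≤ ‖π‖ := fun y hy hy1 => hmax ⟨⟨hy, hy1.le⟩, hy1⟩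
  have hπ0 : π ≠ 0 := by
    rintro rfl
    have := hmax' p hpM (norm_prime.trans_lt inv_prime_lt_one)
    rw [norm_prime, norm_zero] at this
    exact this.not_gt inv_prime_pos
  refine ⟨π, hπM, hπ, fun y hy hy1 => ⟨y / π, div_mem hy hπM, ?_, (mul_div_cancel₀ y hπ0).symm⟩⟩
  rw [norm_div]
  exact div_le_one_of_le₀ (hmax' y hy hy1) (norm_nonneg _)

namespace IsUniformizer

variable {M : IntermediateField ℚ_[p] (PadicAlgCl p)} {π : PadicAlgCl p}

theorem norm_le (hπ : IsUniformizer M π) {y : PadicAlgCl p} (hy : y ∈ M) (hy1 : ‖y‖ < 1) :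
    ‖y‖ ≤ ‖π‖ := by
  obtain ⟨z, -, hz, rfl⟩ := hπ.2.2 y hy hy1
  rw [norm_mul]
  exact mul_le_of_le_one_right (norm_nonneg _) hz

theorem norm_pos (hπ : IsUniformizer M π) : 0 < ‖π‖ :=
  inv_prime_pos.trans_le <| norm_prime (p := p) ▸
    hπ.norm_le (natCast_mem M p) (norm_prime.trans_lt inv_prime_lt_one)

theorem ne_zero (hπ : IsUniformizer M π) : π ≠ 0 := norm_pos_iff.mp hπ.norm_pos

theorem congr_norm (hπ : IsUniformizer M π) {x : PadicAlgCl p} (hx : x ∈ M)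
    (h : ‖x‖ = ‖π‖) : IsUniformizer M x := by
  have hx0 : x ≠ 0 := norm_pos_iff.mp (h ▸ hπ.norm_pos)
  refine ⟨hx, h ▸ hπ.2.1, fun y hy hy1 => ⟨y / x, div_mem hy hx, ?_, (mul_div_cancel₀ y hx0).symm⟩⟩
  rw [norm_div, h]
  exact div_le_one_of_le₀ (hπ.norm_le hy hy1) (norm_nonneg _)

theorem exists_norm_eq_zpow (hπ : IsUniformizer M π) {y : PadicAlgCl p} (hy : y ∈ M)
    (hy0 : y ≠ 0) : ∃ k : ℤ, ‖y‖ = ‖π‖ ^ k := by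
  have h1 : 1 < ‖π‖⁻¹ := (one_lt_inv₀ hπ.norm_pos).mpr hπ.2.1
  obtain ⟨k, hk, hk'⟩ := exists_mem_Ioc_zpow (norm_pos_iff.mpr hy0) h1
  rw [inv_zpow'] at hk hk'
  refine ⟨-(k + 1), le_antisymm hk' ?_⟩
  by_contra! hlt
  have hπk : 0 < ‖π‖ ^ (-(k + 1)) := zpow_pos hπ.norm_pos _
  have hu : ‖y / π ^ (-(k + 1))‖ ≤ ‖π‖ := by
    refine hπ.norm_le (div_mem hy (zpow_mem hπ.1 _)) ?_
    rw [norm_div, norm_zpow, div_lt_one hπk]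
    exact hlt
  rw [norm_div, norm_zpow, div_le_iff₀ hπk, ← zpow_one_add₀ hπ.norm_pos.ne'] at hu
  rw [show 1 + -(k + 1) = -k by ring] at hu
  exact hu.not_gt hk

theorem exists_int_norm_sub_le (hπ : IsUniformizer M π) (hM : TrivialResidue M)
    {y : PadicAlgCl p} (hy : y ∈ M) (hy1 : ‖y‖ ≤ 1) : ∃ k : ℤ, ‖y - k‖ ≤ ‖π‖ := by
  obtain ⟨k, hk⟩ := hM y hy hy1
  exact ⟨k, hπ.norm_le (sub_mem hy (intCast_mem M k)) hk⟩

/-- Over a trivial residue field, `z` agrees with an integer multiple of `w` to leading order. -/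
theorem exists_int_norm_sub_mul_le (hπ : IsUniformizer M π) (hM : TrivialResidue M)
    {z w : PadicAlgCl p} (hz : z ∈ M) (hw : w ∈ M) (h : ‖z‖ = ‖w‖) :
    ∃ k : ℤ, ‖z - k * w‖ ≤ ‖π‖ * ‖z‖ := by
  by_cases hw0 : w = 0
  · exact ⟨0, by simp_all⟩
  obtain ⟨k, hk⟩ := hπ.exists_int_norm_sub_le hM (div_mem hz hw)
    (by rw [norm_div, h, div_self (norm_ne_zero_iff.mpr hw0)])
  refine ⟨k, ?_⟩
  have : z - k * w = (z / w - k) * w := by field_simp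
  rw [this, norm_mul, h]
  gcongr

/-- This is `ef = [M : ℚ_p]` with `f = 1`. If `p` has valuation `k`, the elements `p^a π^i` with `0
≤ i < k` realize every valuation, so successive approximation shows that `1, π, …, π^(k-1)` span
`M`. -/
theorem norm_pow_finrank [FiniteDimensional ℚ_[p] M] (hπ : IsUniformizer M π)
    (hM : TrivialResidue M) : ‖π‖ ^ Module.finrank ℚ_[p] M = (p : ℝ)⁻¹ := by
  obtain ⟨k, hk⟩ := hπ.exists_norm_eq_zpow (natCast_mem M p)
    (Nat.cast_ne_zero.mpr (Fact.out : p.Prime).ne_zero)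
  rw [norm_prime] at hk
  have hk0 : 0 < k := by
    by_contra! h
    have := one_le_zpow_of_nonpos₀ hπ.norm_pos hπ.2.1.le h
    exact (hk ▸ this).not_gt inv_prime_lt_one
  lift k to ℕ using hk0.le
  rw [zpow_natCast] at hk
  have hle := ramification_le_finrank hk.symm hπ.1
  suffices h : Module.finrank ℚ_[p] M ≤ k by rw [le_antisymm h hle, hk]
  let W : Submodule ℚ_[p] (PadicAlgCl p) :=
    Submodule.span ℚ_[p] (Set.range fun i : Fin k => π ^ (i : ℕ))
  have hWM : W ≤ Subalgebra.toSubmodule M.toSubalgebra := by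
    rw [Submodule.span_le]
    rintro _ ⟨i, rfl⟩
    exact pow_mem hπ.1 _
  have hfin : FiniteDimensional ℚ_[p] W := FiniteDimensional.span_of_finite _ (Set.finite_range _)
  have hMW : Subalgebra.toSubmodule M.toSubalgebra ≤ W := by
    intro y hy
    refine mem_of_forall_exists_closer W hπ.norm_pos.le hπ.2.1 y fun x hx => ?_
    by_cases hyx : y - x = 0
    · exact ⟨x, hx, by simp [hyx]⟩
    have hyxM : y - x ∈ M := sub_mem hy (hWM hx)
    obtain ⟨v, hv⟩ := hπ.exists_norm_eq_zpow hyxM hyx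
    have hk' : (0 : ℤ) < k := hk0
    have hi : (v % k).toNat < k := by
      have := Int.emod_lt_of_pos v hk'
      omega
    set w : PadicAlgCl p := (p : ℚ_[p]) ^ (v / k) • π ^ (v % k).toNat with hwdef
    have hw : w ∈ W := W.smul_mem _ (Submodule.subset_span ⟨⟨_, hi⟩, rfl⟩)
    have hnorm : ‖y - x‖ = ‖w‖ := by
      rw [hv, hwdef, norm_smul, norm_zpow, Padic.norm_p, norm_pow, hk, ← zpow_natCast,
        ← zpow_natCast, ← zpow_mul, ← zpow_add₀ hπ.norm_pos.ne',
        Int.toNat_of_nonneg (Int.emod_nonneg _ hk'.ne'), Int.mul_ediv_add_emod]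
    obtain ⟨a, ha⟩ := hπ.exists_int_norm_sub_mul_le hM hyxM (hWM hw) hnorm
    refine ⟨x + a * w, W.add_mem hx ?_, by rwa [← sub_sub]⟩
    have : (a : PadicAlgCl p) * w = (a : ℚ_[p]) • w := by simp [Algebra.smul_def]
    rw [this]
    exact W.smul_mem _ hw
  calc Module.finrank ℚ_[p] M ≤ Module.finrank ℚ_[p] W := Submodule.finrank_mono hMW
    _ ≤ Fintype.card (Fin k) := finrank_range_le_card _
    _ = k := Fintype.card_fin k

theorem exists_norm_sub_aeval_le (hπ : IsUniformizer M π) (hM : TrivialResidue M) (N : ℕ)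
    {x : PadicAlgCl p} (hx : x ∈ M) (hx1 : ‖x‖ ≤ 1) :
    ∃ R : ℤ[X], ‖x - aeval π R‖ ≤ ‖π‖ ^ N := by
  induction N generalizing x with
  | zero => exact ⟨0, by simpa using hx1⟩
  | succ N ih =>
    obtain ⟨k, hk⟩ := hM x hx hx1
    obtain ⟨y, hy, hy1, hxy⟩ := hπ.2.2 _ (sub_mem hx (intCast_mem M k)) hk
    obtain ⟨R, hR⟩ := ih hy hy1
    refine ⟨C k + X * R, ?_⟩
    have : x - aeval π (C k + X * R) = π * (y - aeval π R) := by
      simp only [map_add, map_mul, aeval_X, eq_intCast, map_intCast]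
      rw [mul_sub, ← hxy]
      ring
    rw [this, norm_mul, pow_succ']
    gcongr

variable {L : IntermediateField ℚ_[p] (PadicAlgCl p)} {ϖ : PadicAlgCl p}

/-- The distance from a point outside `L` to a suitable point of `L` is not the norm of an element
of `L`. -/
theorem exists_norm_sub_ne (hπ : IsUniformizer M π) (hM : TrivialResidue M) (hLM : L ≤ M)
    [FiniteDimensional ℚ_[p] L] {z : PadicAlgCl p} (hz : z ∈ M) (hzL : z ∉ L) :
    ∃ x ∈ L, ∀ y ∈ L, ‖z - x‖ ≠ ‖y‖ := by
  by_contra! h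
  have : FiniteDimensional ℚ_[p] (Subalgebra.toSubmodule L.toSubalgebra) :=
    inferInstanceAs (FiniteDimensional ℚ_[p] L)
  refine hzL (mem_of_forall_exists_closer (Subalgebra.toSubmodule L.toSubalgebra)
    hπ.norm_pos.le hπ.2.1 z fun x hx => ?_)
  obtain ⟨y, hy, hxy⟩ := h x hx
  obtain ⟨a, ha⟩ := hπ.exists_int_norm_sub_mul_le hM (sub_mem hz (hLM hx)) (hLM hy) hxy
  exact ⟨x + a * y, L.add_mem hx (L.mul_mem (intCast_mem L a) hy), by rwa [← sub_sub]⟩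

theorem exists_zpow_mul_zpow (hϖ : IsUniformizer L ϖ) (hL : TrivialResidue L)
    (hπ : IsUniformizer M π) (hM : TrivialResidue M) (hLM : L ≤ M)
    [FiniteDimensional ℚ_[p] L] (hnorm : ‖ϖ‖ = ‖π‖ ^ p) {z : PadicAlgCl p} (hz : z ∈ M)
    (hzL : z ∉ L) (hz1 : ‖z‖ = 1) {t : PadicAlgCl p} (ht : t ∈ M) {n : ℕ}
    (htn : ‖t‖ = ‖π‖ ^ p ^ n) :
    ∃ (R : ℤ[X]) (α β : ℤ), IsUniformizer M (t ^ α * (z - aeval ϖ R) ^ β) := by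
  obtain ⟨x, hx, hxn⟩ := hπ.exists_norm_sub_ne hM hLM hz hzL
  -- If `‖x‖ > 1 = ‖z‖`, then `‖z - x‖ = ‖x‖` would be a norm from `L`.
  have hx1 : ‖x‖ ≤ 1 := by
    by_contra! h
    refine hxn x hx ?_
    rw [norm_sub_rev, sub_eq_add_neg,
      IsUltrametricDist.norm_add_eq_max_of_norm_ne_norm (by rw [norm_neg, hz1]; exact h.ne'),
      norm_neg, hz1, max_eq_left h.le]
  have hpos : 0 < ‖z - x‖ := norm_pos_iff.mpr fun h => hzL (sub_eq_zero.mp h ▸ hx)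
  obtain ⟨N, hN⟩ := exists_pow_lt_of_lt_one hpos hϖ.2.1
  obtain ⟨R, hR⟩ := hϖ.exists_norm_sub_aeval_le hL N hx hx1
  have hRL : aeval ϖ R ∈ L := by
    rw [aeval_def, eval₂_eq_sum]
    exact sum_mem fun i _ => L.mul_mem (by simp) (pow_mem hϖ.1 i)
  have hzR : ‖z - aeval ϖ R‖ = ‖z - x‖ := by
    have hlt : ‖x - aeval ϖ R‖ < ‖z - x‖ := hR.trans_lt hN
    rw [← sub_add_sub_cancel z x, IsUltrametricDist.norm_add_eq_max_of_norm_ne_norm hlt.ne',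
      max_eq_left hlt.le]
  have hzRM : z - aeval ϖ R ∈ M := sub_mem hz (hLM hRL)
  obtain ⟨c, hc⟩ := hπ.exists_norm_eq_zpow hzRM (norm_pos_iff.mp (hzR ▸ hpos))
  -- The norms from `L` include all powers of `‖ϖ‖ = ‖π‖ ^ p`.
  have hpc : ¬ (p : ℤ) ∣ c := by
    rintro ⟨d, rfl⟩
    refine hxn (ϖ ^ d) (zpow_mem hϖ.1 d) ?_
    rw [← hzR, hc, norm_zpow, hnorm, zpow_mul, zpow_natCast]
  have hcop : IsCoprime ((p : ℤ) ^ n) c :=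
    IsCoprime.pow_left (((Nat.prime_iff_prime_int.mp Fact.out).coprime_iff_not_dvd).mpr hpc)
  obtain ⟨α, β, hαβ⟩ := hcop
  refine ⟨R, α, β, hπ.congr_norm (M.mul_mem (zpow_mem ht _) (zpow_mem hzRM _)) ?_⟩
  rw [norm_mul, norm_zpow, norm_zpow, htn, hc, ← zpow_natCast, ← zpow_mul, ← zpow_mul,
    ← zpow_add₀ hπ.norm_pos.ne']
  push_cast
  rw [mul_comm _ α, mul_comm c, hαβ, zpow_one]

end IsUniformizer

/-! ### Cyclotomic extensions of `p`-power level -/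

theorem norm_eq_one_of_pow_eq_one {x : PadicAlgCl p} {N : ℕ} (hN : N ≠ 0) (hx : x ^ N = 1) :
    ‖x‖ = 1 := by
  have h : ‖x‖ ^ N = 1 := by rw [← norm_pow, hx, norm_one]
  exact (pow_eq_one_iff_of_nonneg (norm_nonneg x) hN).mp h

theorem norm_one_sub_pow_le {x : PadicAlgCl p} (hx : ‖x‖ ≤ 1) (k : ℕ) :
    ‖1 - x ^ k‖ ≤ ‖1 - x‖ := by
  rw [← mul_neg_geom_sum x k, norm_mul]
  refine mul_le_of_le_one_right (norm_nonneg _) ?_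
  refine IsUltrametricDist.norm_sum_le_of_forall_le_of_nonneg zero_le_one fun i _ => ?_
  rw [norm_pow]
  exact pow_le_one₀ (norm_nonneg x) hx

/-- The distance to `1` of a primitive root of unity of `p`-power order. -/
theorem norm_sub_one_pow_totient {z : PadicAlgCl p} {m : ℕ} (hm : 1 ≤ m)
    (hz : IsPrimitiveRoot z (p ^ m)) : ‖z - 1‖ ^ (p ^ m).totient = (p : ℝ)⁻¹ := by
  have hp : p.Prime := Fact.out
  have hpm : p ^ m ≠ 0 := pow_ne_zero _ hp.ne_zero
  -- Primitive roots are powers of one another, so all factors of `Φ_{p^m}(1) = ∏ (1 - μ) = p` have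
  -- the same norm.
  have hle : ∀ x y : PadicAlgCl p, IsPrimitiveRoot x (p ^ m) → IsPrimitiveRoot y (p ^ m) →
      ‖1 - y‖ ≤ ‖1 - x‖ := by
    intro x y hx hy
    have : NeZero (p ^ m) := ⟨hpm⟩
    obtain ⟨i, -, rfl⟩ := hx.eq_pow_of_pow_eq_one hy.pow_eq_one
    exact norm_one_sub_pow_le (norm_eq_one_of_pow_eq_one hpm hx.pow_eq_one).le i
  have hprod : ∏ μ ∈ primitiveRoots (p ^ m) (PadicAlgCl p), (1 - μ) = (p : PadicAlgCl p) := by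
    obtain ⟨k, rfl⟩ := Nat.exists_eq_add_of_le' hm
    rw [← eval_one_cyclotomic_prime_pow (R := PadicAlgCl p) k (p := p),
      cyclotomic_eq_prod_X_sub_primitiveRoots hz, eval_prod]
    simp
  have hnorm := congrArg norm hprod
  rw [norm_prod, norm_prime, Finset.prod_congr rfl fun μ hμ => le_antisymm
      (hle z μ hz (isPrimitiveRoot_of_mem_primitiveRoots hμ))
      (hle μ z (isPrimitiveRoot_of_mem_primitiveRoots hμ) hz), Finset.prod_const,
    hz.card_primitiveRoots] at hnorm
  rwa [norm_sub_rev]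

theorem isIntegral_padic (x : PadicAlgCl p) : IsIntegral ℚ_[p] x :=
  (Algebra.IsAlgebraic.isAlgebraic x).isIntegral

instance finiteDimensional_adjoin_simple (x : PadicAlgCl p) :
    FiniteDimensional ℚ_[p] (IntermediateField.adjoin ℚ_[p] {x}) :=
  IntermediateField.adjoin.finiteDimensional (isIntegral_padic x)

instance finiteDimensional_layer (z r : PadicAlgCl p) : FiniteDimensional ℚ_[p] (layer p z r) :=
  IntermediateField.finiteDimensional_adjoin fun x _ => isIntegral_padic x

section Cyclotomic

variable {z : PadicAlgCl p} {m : ℕ} (hm : 1 ≤ m) (hz : IsPrimitiveRoot z (p ^ m))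
include hm hz

/-- The ramification of `z - 1` bounds the degree below, and the degree of the cyclotomic polynomial
bounds it above. -/
theorem finrank_adjoin_primitiveRoot :
    Module.finrank ℚ_[p] (IntermediateField.adjoin ℚ_[p] {z}) = (p ^ m).totient := by
  refine le_antisymm ?_ (ramification_le_finrank (norm_sub_one_pow_totient hm hz)
    (sub_mem (IntermediateField.mem_adjoin_simple_self _ z) (one_mem _)))
  rw [IntermediateField.adjoin.finrank (isIntegral_padic z), ← natDegree_cyclotomic (p ^ m) ℚ_[p]]
  refine natDegree_le_of_dvd (minpoly.dvd _ _ ?_) (cyclotomic_ne_zero _ _)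
  have hpos : 0 < p ^ m := pow_pos (Fact.out : p.Prime).pos m
  have h := hz.isRoot_cyclotomic hpos
  rwa [IsRoot.def, ← map_cyclotomic (p ^ m) (algebraMap ℚ_[p] (PadicAlgCl p)),
    eval_map_algebraMap] at h

theorem trivialResidue_adjoin_primitiveRoot :
    TrivialResidue (IntermediateField.adjoin ℚ_[p] {z}) :=
  trivialResidue_of_ramification_eq_finrank (norm_sub_one_pow_totient hm hz)
    (sub_mem (IntermediateField.mem_adjoin_simple_self _ z) (one_mem _))
    (finrank_adjoin_primitiveRoot hm hz).symm

end Cyclotomic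

/-! ### Roots of `p` and abelian extensions -/

/-- An element outside `M` is moved by some automorphism over `M`. -/
theorem exists_algEquiv_ne {M : IntermediateField ℚ_[p] (PadicAlgCl p)} {x : PadicAlgCl p}
    (hx : x ∉ M) : ∃ σ : Gal(PadicAlgCl p/ℚ_[p]), (∀ y ∈ M, σ y = y) ∧ σ x ≠ x := by
  by_contra! h
  refine hx ?_
  rw [← InfiniteGalois.fixedField_fixingSubgroup M, IntermediateField.mem_fixedField_iff]
  exact fun σ hσ => h σ fun y hy => (IntermediateField.mem_fixingSubgroup_iff M σ).mp hσ y hy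

theorem algEquiv_comm_of_mem_adjoin {η : PadicAlgCl p} {N : ℕ} [NeZero N]
    (hη : IsPrimitiveRoot η N) (σ τ : Gal(PadicAlgCl p/ℚ_[p])) {x : PadicAlgCl p}
    (hx : x ∈ IntermediateField.adjoin ℚ_[p] {η}) : σ (τ x) = τ (σ x) := by
  induction hx using IntermediateField.adjoin_induction with
  | mem x hx =>
    obtain rfl := Set.mem_singleton_iff.mp hx
    obtain ⟨i, -, hi⟩ := hη.eq_pow_of_pow_eq_one
      (show σ x ^ N = 1 by rw [← map_pow, hη.pow_eq_one, map_one])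
    obtain ⟨j, -, hj⟩ := hη.eq_pow_of_pow_eq_one
      (show τ x ^ N = 1 by rw [← map_pow, hη.pow_eq_one, map_one])
    rw [← hi, ← hj, map_pow, map_pow, ← hi, ← hj, ← pow_mul, ← pow_mul, mul_comm]
  | algebraMap x => simp
  | add x y _ _ hx hy => simp [hx, hy]
  | mul x y _ _ hx hy => simp [hx, hy]
  | inv x _ hx => simp [hx]

/-- For odd `p` no `p`-th root of `p` lies in a cyclotomic extension of `ℚ_p`. -/
theorem notMem_adjoin_of_pow_eq_prime (hp : 3 ≤ p) {s η : PadicAlgCl p}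
    (hs : s ^ p = (p : PadicAlgCl p)) {N : ℕ} [NeZero N] (hη : IsPrimitiveRoot η N) :
    s ∉ IntermediateField.adjoin ℚ_[p] {η} := by
  intro hsη
  have hpp : p.Prime := Fact.out
  have : NeZero p := ⟨hpp.ne_zero⟩
  obtain ⟨ξ, hξ⟩ := HasEnoughRootsOfUnity.exists_primitiveRoot (PadicAlgCl p) p
  have hξ1 : IsPrimitiveRoot ξ (p ^ 1) := by rwa [pow_one]
  set F := IntermediateField.adjoin ℚ_[p] {ξ}
  have hF : Module.finrank ℚ_[p] F = p - 1 := by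
    rw [finrank_adjoin_primitiveRoot le_rfl hξ1, pow_one, Nat.totient_prime hpp]
  have hnorm : ‖s‖ ^ p = (p : ℝ)⁻¹ := by rw [← norm_pow, hs, norm_prime]
  have hsF : s ∉ F := fun h => by
    have := ramification_le_finrank hnorm h
    omega
  have hs0 : s ≠ 0 := ramified_ne_zero hnorm hpp.ne_zero
  have hmemF : ∀ x : PadicAlgCl p, x ^ p = 1 → x ∈ F := by
    intro x hx
    obtain ⟨i, -, rfl⟩ := hξ.eq_pow_of_pow_eq_one hx
    exact pow_mem (IntermediateField.mem_adjoin_simple_self _ ξ) i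
  have hdiv : ∀ τ : Gal(PadicAlgCl p/ℚ_[p]), (τ s / s) ^ p = 1 := by
    intro τ
    rw [div_pow, ← map_pow, hs, map_natCast, div_self (Nat.cast_ne_zero.mpr hpp.ne_zero)]
  obtain ⟨σ, hσF, hσs⟩ := exists_algEquiv_ne hsF
  set μ := σ s / s with hμ
  have hμ1 : μ ≠ 1 := fun h => hσs ((div_eq_one_iff_eq hs0).mp h)
  have hμp : IsPrimitiveRoot μ (p ^ 1) := by
    rw [pow_one]
    exact IsPrimitiveRoot.iff_orderOf.mpr (orderOf_eq_prime (hdiv σ) hμ1)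
  -- Here `p` must be odd: `μ` has degree `p - 1 ≥ 2` over `ℚ_p`.
  have hμbot : μ ∉ (⊥ : IntermediateField ℚ_[p] (PadicAlgCl p)) := by
    intro h
    have h1 := finrank_adjoin_primitiveRoot le_rfl hμp
    rw [IntermediateField.adjoin_simple_eq_bot_iff.mpr h, IntermediateField.finrank_bot, pow_one,
      Nat.totient_prime hpp] at h1
    omega
  obtain ⟨τ, -, hτ⟩ := exists_algEquiv_ne hμbot
  apply hτ
  have hσ' : σ s = μ * s := (div_mul_cancel₀ _ hs0).symm
  have hτ' : τ s = τ s / s * s := (div_mul_cancel₀ _ hs0).symm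
  -- Since `σ` fixes the `p`-th root of unity `τ s / s`, equating `σ (τ s) = μ * τ s` with `τ (σ s)
  -- = τ μ * τ s` forces `τ μ = μ`.
  have hcomm := algEquiv_comm_of_mem_adjoin hη σ τ hsη
  rw [hσ', map_mul, hτ', map_mul, hσF _ (hmemF _ (hdiv τ)), hσ'] at hcomm
  have h0 : τ s / s * s ≠ 0 := by
    rw [← hτ']
    exact (map_ne_zero τ).mpr hs0
  refine mul_right_cancel₀ h0 ?_
  rw [← hcomm]
  ring

/-! ### Teichmüller representatives -/

theorem exists_pow_eq_one_norm_sub_lt_one {x : PadicAlgCl p} {N : ℕ} (hN : N ≠ 0)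
    (hx : ‖x ^ N - 1‖ < 1) : ∃ ω : PadicAlgCl p, ω ^ N = 1 ∧ ‖x - ω‖ < 1 := by
  have : NeZero N := ⟨hN⟩
  have : NeZero (N : PadicAlgCl p) := ⟨Nat.cast_ne_zero.mpr hN⟩
  obtain ⟨ζ, hζ⟩ := HasEnoughRootsOfUnity.exists_primitiveRoot (PadicAlgCl p) N
  by_contra! h
  have hprod := congrArg (eval x) (X_pow_sub_one_eq_prod (Nat.pos_of_ne_zero hN) hζ)
  simp only [eval_sub, eval_pow, eval_X, eval_one, eval_prod, eval_C] at hprod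
  rw [hprod, norm_prod] at hx
  refine hx.not_ge ?_
  rw [← Finset.prod_const_one (s := nthRootsFinset N (1 : PadicAlgCl p))]
  exact Finset.prod_le_prod (fun _ _ => zero_le_one) fun ω hω =>
    h ω ((mem_nthRootsFinset (Nat.pos_of_ne_zero hN) 1).mp hω)

theorem norm_sub_one_lt_one_of_pow_prime {x : PadicAlgCl p} (hx : ‖x ^ p - 1‖ < 1) :
    ‖x - 1‖ < 1 := by
  have hpp : p.Prime := Fact.out
  obtain ⟨ξ, hξ, hxξ⟩ := exists_pow_eq_one_norm_sub_lt_one hpp.ne_zero hx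
  have hξ1 : ‖ξ - 1‖ < 1 := by
    by_cases h : ξ = 1
    · simp [h]
    have hprim : IsPrimitiveRoot ξ (p ^ 1) := by
      rw [pow_one]
      exact IsPrimitiveRoot.iff_orderOf.mpr (orderOf_eq_prime hξ h)
    by_contra! hge
    exact (one_le_pow₀ hge).not_gt
      ((norm_sub_one_pow_totient le_rfl hprim).trans_lt inv_prime_lt_one)
  rw [← sub_add_sub_cancel x ξ 1]
  exact (IsUltrametricDist.norm_add_le_max _ _).trans_lt (max_lt hxξ hξ1)

theorem norm_sub_one_lt_one_of_pow_prime_pow {x : PadicAlgCl p} (a : ℕ)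
    (hx : ‖x ^ p ^ a - 1‖ < 1) : ‖x - 1‖ < 1 := by
  induction a with
  | zero => simpa using hx
  | succ a ih =>
    refine ih (norm_sub_one_lt_one_of_pow_prime ?_)
    rwa [← pow_mul, ← pow_succ]

/-- Roots of unity of order prime to `p` are pairwise incongruent. -/
theorem eq_one_of_pow_eq_one_of_norm_sub_lt_one {x : PadicAlgCl p} {N : ℕ} (hN : ¬ p ∣ N)
    (hx : x ^ N = 1) (hx1 : ‖x - 1‖ < 1) : x = 1 := by
  by_contra hne
  have hN0 : N ≠ 0 := fun h => hN (h ▸ dvd_zero p)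
  have hxn : ‖x‖ = 1 := norm_eq_one_of_pow_eq_one hN0 hx
  have hgeom : ∑ i ∈ Finset.range N, x ^ i = 0 := by
    have h := mul_geom_sum x N
    rw [hx, sub_self] at h
    exact (mul_eq_zero.mp h).resolve_left (sub_ne_zero.mpr hne)
  have hsum : (N : PadicAlgCl p) = ∑ i ∈ Finset.range N, (1 - x ^ i) := by
    simp [Finset.sum_sub_distrib, hgeom]
  have hle : ‖(N : PadicAlgCl p)‖ ≤ ‖1 - x‖ := by
    rw [hsum]
    exact IsUltrametricDist.norm_sum_le_of_forall_le_of_nonneg (norm_nonneg _)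
      fun i _ => norm_one_sub_pow_le hxn.le i
  have hNn : ‖(N : PadicAlgCl p)‖ = 1 := by
    rw [← map_natCast (algebraMap ℚ_[p] (PadicAlgCl p)), norm_algebraMap',
      Padic.norm_natCast_eq_one_iff]
    exact (Nat.Prime.coprime_iff_not_dvd Fact.out).mpr hN
  rw [hNn, norm_sub_rev] at hle
  exact hle.not_gt hx1

/-- Teichmüller representatives of units. -/
theorem exists_rootOfUnity_near {M : IntermediateField ℚ_[p] (PadicAlgCl p)}
    [FiniteDimensional ℚ_[p] M] {x : PadicAlgCl p} (hx : x ∈ M) (hx1 : ‖x‖ = 1) :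
    ∃ ω ∈ M, ‖x - ω‖ < 1 ∧ ∃ N : ℕ, ¬ p ∣ N ∧ ω ^ N = 1 := by
  have hpp : p.Prime := Fact.out
  obtain ⟨y, -, φ, hφ, hlim⟩ := (isCompact_integers M).tendsto_subseq (x := fun k : ℕ => x ^ k)
    fun k => ⟨pow_mem hx k, by simp [hx1]⟩
  -- By compactness two powers of `x` are congruent, so some positive power of `x` is congruent to
  -- `1`; the `p`-part of its exponent can then be dropped.
  obtain ⟨K, hK⟩ := Metric.cauchySeq_iff.mp hlim.cauchySeq 1 one_pos
  have hlt := hφ K.lt_succ_self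
  have hd := hK (K + 1) K.le_succ K le_rfl
  obtain ⟨N, hN⟩ := Nat.exists_eq_add_of_lt hlt
  simp only [Function.comp_apply, dist_eq_norm, Nat.succ_eq_add_one] at hd hN
  have hxN : ‖x ^ (N + 1) - 1‖ < 1 := by
    rw [hN] at hd
    have : x ^ (φ K + N + 1) - x ^ φ K = x ^ φ K * (x ^ (N + 1) - 1) := by ring
    rwa [this, norm_mul, norm_pow, hx1, one_pow, one_mul] at hd
  obtain ⟨a, L, hL, hNL⟩ := Nat.exists_eq_pow_mul_and_not_dvd N.succ_ne_zero p hpp.ne_one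
  have hxL : ‖x ^ L - 1‖ < 1 := by
    refine norm_sub_one_lt_one_of_pow_prime_pow a ?_
    rwa [← pow_mul, mul_comm L, ← hNL]
  have hL0 : L ≠ 0 := fun h => hL (h ▸ dvd_zero p)
  obtain ⟨ω, hω, hxω⟩ := exists_pow_eq_one_norm_sub_lt_one hL0 hxL
  refine ⟨ω, ?_, hxω, L, hL, hω⟩
  -- A conjugate of `ω` over `M` is again congruent to `x`, hence to `ω`, hence equal to `ω`.
  by_contra hωM
  obtain ⟨σ, hσM, hσω⟩ := exists_algEquiv_ne hωM
  have hω1 : ‖ω‖ = 1 := norm_eq_one_of_pow_eq_one hL0 hω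
  have hω0 : ω ≠ 0 := norm_ne_zero_iff.mp (by rw [hω1]; exact one_ne_zero)
  refine hσω ((div_eq_one_iff_eq hω0).mp (eq_one_of_pow_eq_one_of_norm_sub_lt_one hL ?_ ?_))
  · rw [div_pow, ← map_pow, hω, map_one, div_one]
  · have h1 : ‖x - σ ω‖ < 1 := by rwa [← hσM x hx, ← map_sub, norm_algEquiv]
    rw [← div_self hω0, ← sub_div, norm_div, hω1, div_one, ← sub_add_sub_cancel _ x ω]
    refine (IsUltrametricDist.norm_add_le_max _ _).trans_lt (max_lt ?_ hxω)
    rwa [norm_sub_rev]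

/-! ### Degree and residue field of the layers -/

theorem finrank_layer (hp : 3 ≤ p) {η r : PadicAlgCl p} {N : ℕ} [NeZero N]
    (hη : IsPrimitiveRoot η N) {n : ℕ} (hr : r ^ p ^ n = (p : PadicAlgCl p)) :
    Module.finrank ℚ_[p] (layer p η r) =
      Module.finrank ℚ_[p] (IntermediateField.adjoin ℚ_[p] {η}) * p ^ n := by
  have hpp : p.Prime := Fact.out
  set E := IntermediateField.adjoin ℚ_[p] {η} with hE
  have hirr : Irreducible (X ^ p ^ n - C (p : E)) := by
    refine X_pow_sub_C_irreducible_of_prime_pow hpp (by omega) n fun b hb => ?_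
    refine notMem_adjoin_of_pow_eq_prime hp (s := (b : PadicAlgCl p)) ?_ hη b.2
    exact_mod_cast congrArg (fun x : E => (x : PadicAlgCl p)) hb
  have hpn : p ^ n ≠ 0 := pow_ne_zero _ hpp.ne_zero
  have hdeg : Module.finrank E (IntermediateField.adjoin E {r}) = p ^ n := by
    rw [IntermediateField.adjoin.finrank ((isIntegral_padic r).tower_top),
      ← minpoly.eq_of_irreducible_of_monic hirr (by simp [hr]) (monic_X_pow_sub_C _ hpn),
      natDegree_X_pow_sub_C]
  have hlayer : layer p η r =
      (IntermediateField.adjoin E {r}).restrictScalars ℚ_[p] := by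
    rw [IntermediateField.adjoin_adjoin_left, layer, Set.singleton_union]
  rw [← hdeg, hlayer, Module.finrank_mul_finrank ℚ_[p] E (IntermediateField.adjoin E {r})]
  rfl

section Layer

variable (hp : 3 ≤ p) {z r : PadicAlgCl p} {m n : ℕ} (hm : 1 ≤ m)
  (hz : IsPrimitiveRoot z (p ^ m)) (hr : r ^ p ^ n = (p : PadicAlgCl p))
include hp hm hz hr

theorem finrank_layer_primitiveRoot :
    Module.finrank ℚ_[p] (layer p z r) = (p ^ m).totient * p ^ n := by
  have : NeZero (p ^ m) := ⟨pow_ne_zero _ (Fact.out : p.Prime).ne_zero⟩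
  rw [finrank_layer hp hz hr, finrank_adjoin_primitiveRoot hm hz]

theorem trivialResidue_layer : TrivialResidue (layer p z r) := by
  have hpp : p.Prime := Fact.out
  intro y hy hy1
  rcases hy1.lt_or_eq with hlt | hy1
  · exact ⟨0, by simpa using hlt⟩
  obtain ⟨ω, hωM, hyω, N, hN, hωN⟩ := exists_rootOfUnity_near hy hy1
  have hN0 : N ≠ 0 := fun h => hN (h ▸ dvd_zero p)
  set d := orderOf ω
  have hd0 : d ≠ 0 := (orderOf_pos_iff.mpr (isOfFinOrder_iff_pow_eq_one.mpr
    ⟨N, Nat.pos_of_ne_zero hN0, hωN⟩)).ne'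
  have hpd : ¬ p ∣ d := fun h => hN (h.trans (orderOf_dvd_of_pow_eq_one hωN))
  have hcop : (p ^ m).Coprime d :=
    Nat.Coprime.pow_left m ((Nat.Prime.coprime_iff_not_dvd hpp).mpr hpd)
  have hη : IsPrimitiveRoot (z * ω) (p ^ m * d) := by
    rw [hz.eq_orderOf] at hcop ⊢
    exact IsPrimitiveRoot.iff_orderOf.mpr <| (Commute.all z ω).orderOf_mul_eq_mul_orderOf_of_coprime hcop
  have : NeZero (p ^ m * d) := ⟨mul_ne_zero (pow_ne_zero _ hpp.ne_zero) hd0⟩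
  set E := IntermediateField.adjoin ℚ_[p] {z * ω}
  set F := IntermediateField.adjoin ℚ_[p] {z}
  have hmem : ∀ x : PadicAlgCl p, x ^ (p ^ m * d) = 1 → x ∈ E := by
    intro x hx
    obtain ⟨i, -, rfl⟩ := hη.eq_pow_of_pow_eq_one hx
    exact pow_mem (IntermediateField.mem_adjoin_simple_self _ _) i
  have hzE : z ∈ E := hmem z (by rw [pow_mul, hz.pow_eq_one, one_pow])
  have hωE : ω ∈ E := hmem ω (by rw [mul_comm, pow_mul, pow_orderOf_eq_one, one_pow])
  have hFE : F ≤ E := IntermediateField.adjoin_simple_le_iff.mpr hzE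
  have hzM : z ∈ layer p z r := IntermediateField.subset_adjoin _ _ (by simp)
  have hrM : r ∈ layer p z r := IntermediateField.subset_adjoin _ _ (by simp)
  have hle : layer p (z * ω) r ≤ layer p z r := by
    refine IntermediateField.adjoin_le_iff.mpr ?_
    rintro x (rfl | rfl)
    exacts [mul_mem hzM hωM, hrM]
  have hfin := IntermediateField.finrank_le_of_le_right hle
  have : NeZero (p ^ m) := ⟨pow_ne_zero _ hpp.ne_zero⟩
  -- Adjoining `r` multiplies both degrees by the same `p ^ n`, so `ω` already lies in the totally
  -- ramified field `ℚ_p(z)`.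
  rw [finrank_layer hp hη hr, finrank_layer hp hz hr] at hfin
  have hEF : F = E := IntermediateField.eq_of_le_of_finrank_le hFE
    (Nat.le_of_mul_le_mul_right hfin (pow_pos hpp.pos n))
  obtain ⟨k, hk⟩ := trivialResidue_adjoin_primitiveRoot hm hz ω
    (show ω ∈ F by rwa [hEF])
    (norm_eq_one_of_pow_eq_one hN0 hωN).le
  refine ⟨k, ?_⟩
  rw [← sub_add_sub_cancel y ω]
  exact (IsUltrametricDist.norm_add_le_max _ _).trans_lt (max_lt hyω hk)

end Layer

/-! ### The recursion -/

theorem exists_isUniformizer_layer_succ (hp : 3 ≤ p) {z z' r ϖ : PadicAlgCl p} {m n : ℕ}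
    (hm : 1 ≤ m) (hz : IsPrimitiveRoot z (p ^ m)) (hz' : IsPrimitiveRoot z' (p ^ (m + 1)))
    (hr : r ^ p ^ n = (p : PadicAlgCl p)) (hϖ : IsUniformizer (layer p z r) ϖ) :
    ∃ (R : (localizedInt p)[X]) (α β : ℤ),
      IsUniformizer (layer p z' r) ((z' - 1) ^ α * (z' - aeval ϖ R) ^ β) := by
  have hpp : p.Prime := Fact.out
  have hm' : 1 ≤ m + 1 := by omega
  have : NeZero (p ^ (m + 1)) := ⟨pow_ne_zero _ hpp.ne_zero⟩
  set L := layer p z r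
  set M := layer p z' r
  have hLres : TrivialResidue L := trivialResidue_layer hp hm hz hr
  have hMres : TrivialResidue M := trivialResidue_layer hp hm' hz' hr
  have hz'M : z' ∈ M := IntermediateField.subset_adjoin _ _ (by simp)
  have hrM : r ∈ M := IntermediateField.subset_adjoin _ _ (by simp)
  have hrL : r ∈ L := IntermediateField.subset_adjoin _ _ (by simp)
  have hLM : L ≤ M := by
    refine IntermediateField.adjoin_le_iff.mpr ?_
    obtain ⟨i, -, hi⟩ := hz'.eq_pow_of_pow_eq_one
      (show z ^ p ^ (m + 1) = 1 by rw [pow_succ, pow_mul, hz.pow_eq_one, one_pow])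
    rintro x (rfl | rfl)
    exacts [hi ▸ pow_mem hz'M i, hrM]
  have hLfin : Module.finrank ℚ_[p] L = (p ^ m).totient * p ^ n :=
    finrank_layer_primitiveRoot hp hm hz hr
  have hMfin : Module.finrank ℚ_[p] M = (p ^ (m + 1)).totient * p ^ n :=
    finrank_layer_primitiveRoot hp hm' hz' hr
  have htot : (p ^ (m + 1)).totient = p * (p ^ m).totient := by
    rw [pow_succ', Nat.totient_mul_of_prime_of_dvd hpp (dvd_pow_self p (by omega))]
  have hMLfin : Module.finrank ℚ_[p] M = p * Module.finrank ℚ_[p] L := by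
    rw [hMfin, hLfin, htot, mul_assoc]
  have hLpos : 0 < Module.finrank ℚ_[p] L := Module.finrank_pos
  have hz'L : z' ∉ L := by
    intro h
    have hML : M ≤ L := by
      refine IntermediateField.adjoin_le_iff.mpr ?_
      rintro x (rfl | rfl)
      exacts [h, hrL]
    have := IntermediateField.finrank_le_of_le_right hML
    nlinarith
  obtain ⟨π, hπ⟩ := exists_isUniformizer M
  have hπn := hπ.norm_pow_finrank hMres
  have hϖn := hϖ.norm_pow_finrank hLres
  have hnorm : ‖ϖ‖ = ‖π‖ ^ p := by
    refine (pow_left_inj₀ (norm_nonneg _) (by positivity) hLpos.ne').mp ?_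
    rw [hϖn, ← pow_mul, ← hMLfin, hπn]
  have htn : ‖z' - 1‖ = ‖π‖ ^ p ^ n := by
    have hpos : 0 < (p ^ (m + 1)).totient := Nat.totient_pos.mpr (pow_pos hpp.pos _)
    refine (pow_left_inj₀ (norm_nonneg _) (by positivity) hpos.ne').mp ?_
    rw [norm_sub_one_pow_totient hm' hz', ← pow_mul, mul_comm, ← hMfin, hπn]
  obtain ⟨R, α, β, hR⟩ := hϖ.exists_zpow_mul_zpow hLres hπ hMres hLM hnorm hz'M hz'L
    (norm_eq_one_of_pow_eq_one (NeZero.ne _) hz'.pow_eq_one) (sub_mem hz'M (one_mem _)) htn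
  refine ⟨R.map (algebraMap ℤ (localizedInt p)), α, β, ?_⟩
  rwa [aeval_map_algebraMap]

end FalseTate

theorem theorem1p2 (p : ℕ) [Fact p.Prime] (hp : 3 ≤ p)
    (ζ : ℕ → PadicAlgCl p) (hζ : ∀ m : ℕ, IsPrimitiveRoot (ζ m) (p ^ m))
    (n : ℕ) (hn : 1 ≤ n)
    (r : PadicAlgCl p) (hr : r ^ (p ^ n) = (p : PadicAlgCl p)) :
    (∃ ϖ : PadicAlgCl p, FalseTate.IsUniformizer (FalseTate.layer p (ζ 2) r) ϖ) ∧
    ∀ ϖ : PadicAlgCl p, FalseTate.IsUniformizer (FalseTate.layer p (ζ 2) r) ϖ →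
      ∃ (R : ℕ → Polynomial (FalseTate.localizedInt p)) (α β : ℕ → ℤ),
        ∀ m : ℕ, 3 ≤ m →
          FalseTate.IsUniformizer (FalseTate.layer p (ζ m) r)
            (FalseTate.recursiveSeq ζ R α β ϖ m) := by
  refine ⟨FalseTate.exists_isUniformizer _, fun ϖ hϖ => ?_⟩
  -- The uniformizer hypothesis sits inside the existential, so that `choose` yields functions of
  -- `k` and `x` alone, from which `q` can be built by plain recursion.
  have hstep : ∀ (k : ℕ) (x : PadicAlgCl p), ∃ (R : Polynomial (FalseTate.localizedInt p))
      (α β : ℤ), FalseTate.IsUniformizer (FalseTate.layer p (ζ (k + 2)) r) x →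
        FalseTate.IsUniformizer (FalseTate.layer p (ζ (k + 3)) r)
          ((ζ (k + 3) - 1) ^ α * (ζ (k + 3) - Polynomial.aeval x R) ^ β) := by
    intro k x
    by_cases hx : FalseTate.IsUniformizer (FalseTate.layer p (ζ (k + 2)) r) x
    · obtain ⟨R, α, β, h⟩ := FalseTate.exists_isUniformizer_layer_succ hp (by omega)
        (hζ (k + 2)) (hζ (k + 3)) hr hx
      exact ⟨R, α, β, fun _ => h⟩
    · exact ⟨0, 0, 0, fun h => absurd h hx⟩
  choose R α β hRαβ using hstep
  let q : ℕ → PadicAlgCl p := Nat.rec ϖ fun k x =>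
    (ζ (k + 3) - 1) ^ α k x * (ζ (k + 3) - Polynomial.aeval x (R k x)) ^ β k x
  -- `q k` is `π_{k+2}`, so the data at index `m` are those chosen for `q (m - 3) = π_{m-1}`.
  have hq : ∀ k, FalseTate.recursiveSeq ζ (fun m => R (m - 3) (q (m - 3)))
      (fun m => α (m - 3) (q (m - 3))) (fun m => β (m - 3) (q (m - 3))) ϖ (k + 2) = q k := by
    intro k
    induction k with
    | zero => rfl
    | succ k ih =>
      rw [show k + 1 + 2 = k + 3 by rfl, FalseTate.recursiveSeq, ih]
      rfl
  have hunif : ∀ k, FalseTate.IsUniformizer (FalseTate.layer p (ζ (k + 2)) r) (q k) := by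
    intro k
    induction k with
    | zero => exact hϖ
    | succ k ih => exact hRαβ k (q k) ih
  refine ⟨fun m => R (m - 3) (q (m - 3)), fun m => α (m - 3) (q (m - 3)),
    fun m => β (m - 3) (q (m - 3)), fun m hm => ?_⟩
  obtain ⟨k, rfl⟩ := Nat.exists_eq_add_of_le' (show 2 ≤ m by omega)
  rw [hq]
  exact hunif k
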